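/- Let $X$ be a compact metric space with its Borel $\sigma$-algebra. A time-invariant distribution of random flows on $X$ is a family $\mathfrak T=(\mathfrak T^t)_{t\ge 0}$ of Borel probability measures on the space $C(X,X)$ of continuous self-maps of $X$ (with the topology of uniform convergence) such that $\mathfrak T^0=\delta_{\mathrm{id}}$ and such that $T^t\circ T^s\sim\mathfrak T^{t+s}$ whenever $T^t\sim\mathfrak T^t$ and $T^s\sim\mathfrak T^s$ are independent. The averaged push-forward operator acts on Borel probability measures $\nu$ by $(\mathfrak T^t_*\nu)(A)=\mathbb E_{T\sim\mathfrak T^t}[\nu(T^{-1}A)]$, and $\nu$ is called stationary if $\mathfrak T^t_*\nu=\nu$ for all $t\ge 0$. A Borel set $A$ is called invariant if for every $t\geq 0$, for $\mu$-almost every $x$ and $\mathfrak T^t$-almost every $T$, one has $T(x)\in A$ if and only if $x\in A$; the distribution $\mathfrak T$ is called ergodic with respect to a stationary probability measure $\mu$ if $\mu(A)\in\{0,1\}$ for every invariant $A$, and uniquely ergodic (with measure $\mu$) if moreover $\mu$ is its only stationary probability measure. A random flow sampled from $\mathfrak T$ is a random family of continuous maps $T^{s,t}:X\to X$ $(0\le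 s\le t)$ on a probability space, with $T^{s,s}=\mathrm{id}$ and $T^{s,t}\circ T^{r,s}=T^{r,t}$ for $r\le s\le t$, such that each $T^{s,t}$ is measurable in $\omega$, $(\omega,t)\mapsto T^{0,t}_\omega(x)$ is measurable for each $x \in X$, and, for all $s,t\ge 0$, $T^{s,s+t}$ has law $\mathfrak T^t$ (time-invariance) and is independent of $(T^{0,r})_{r\le s}$ (Markov property). Theorem. Let $\mathfrak T$ be a time-invariant distribution of random flows on $X$, and let $\mu$ be a Borel probability measure on $X$. If $\mu$ is stationary and is the only stationary probability measure of $\mathfrak T$, then $\mathfrak T$ is uniquely ergodic with measure $\mu$; in particular it is ergodic with respect to $\mu$. Moreover, if $(T^{s,t})$ is any random flow sampled from $\mathfrak T$ and $x_0\in X$ is any starting point, then almost surely the trajectory $t\mapsto T^{0,t}(x_0)$ is ergodic: for every continuous $f:X\to\mathbb R$, $$\lim_{\tau\to\infty}\frac1\tau\int_0^\tau f\bigl(T^{0,t}(x_0)\bigr)\,dt=\int_X f\,d\mu .$$ -/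

import Mathlib

open MeasureTheory ProbabilityTheory Filter Topology Set
open scoped NNReal ENNReal

/-- The space `C(X, X)` of continuous self-maps of `X`, with the topology of uniform convergence
(for compact `X`), carries its Borel σ-algebra. -/
instance instMeasurableSpaceSelfMaps (X : Type*) [TopologicalSpace X] :
    MeasurableSpace C(X, X) := borel C(X, X)

instance instBorelSpaceSelfMaps (X : Type*) [TopologicalSpace X] :
    BorelSpace C(X, X) := ⟨rfl⟩

/-- A (possibly) time-varying flow on `X`: `φ.map s t` carries the position at time `s` to the
position at time `t`, for `s ≤ t` (the values for `t < s` are irrelevant). -/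
structure TimeVaryingFlow (X : Type*) [TopologicalSpace X] where
  /-- the continuous map that transports positions at time `s` to positions at time `t` -/
  map : ℝ≥0 → ℝ≥0 → C(X, X)
  map_self : ∀ s, map s s = ContinuousMap.id X
  map_comp : ∀ r s t, r ≤ s → s ≤ t → (map s t).comp (map r s) = map r t

/-- A time-invariant distribution of random flows: for each duration `t ≥ 0` a probability law
`𝔗ᵗ` on the continuous self-maps of `X`, with `𝔗⁰` concentrated at the identity, such that
`Tᵗ ∘ Tˢ ∼ 𝔗ᵗ⁺ˢ` whenever `Tᵗ ∼ 𝔗ᵗ` and `Tˢ ∼ 𝔗ˢ` are sampled independently. -/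
structure RandomFlow (X : Type*) [TopologicalSpace X] where
  /-- the law of the transformation over a time interval of length `t` -/
  law : ℝ≥0 → Measure C(X, X)
  isProbabilityMeasure_law : ∀ t, IsProbabilityMeasure (law t)
  law_zero : law 0 = Measure.dirac (ContinuousMap.id X)
  law_add : ∀ t s,
    ((law t).prod (law s)).map (fun p : C(X, X) × C(X, X) => p.1.comp p.2) = law (t + s)

namespace RandomFlow

variable {X : Type*} [MetricSpace X] [CompactSpace X] [MeasurableSpace X] [BorelSpace X]

/-- The averaged push-forward operator `𝔗ᵗ_* ν = 𝔼_{T ∼ 𝔗ᵗ} [T_* ν]`. -/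
noncomputable def avgPush (𝔗 : RandomFlow X) (t : ℝ≥0) (ν : Measure X) : Measure X :=
  (𝔗.law t).bind (fun T => ν.map T)

theorem measurable_eval :
    Measurable (fun p : C(X, X) × X => p.1 p.2) :=
  (continuous_eval : Continuous (fun p : C(X, X) × X => p.1 p.2)).measurable

/-- `(𝔗ᵗ_* ν)(A) = 𝔼_{T ∼ 𝔗ᵗ} [ν (T⁻¹ A)]`. -/
theorem avgPush_apply (𝔗 : RandomFlow X) (t : ℝ≥0) (ν : Measure X) [IsProbabilityMeasure ν]
    {A : Set X} (hA : MeasurableSet A) :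
    𝔗.avgPush t ν A = ∫⁻ T, ν (T ⁻¹' A) ∂(𝔗.law t) := by
  have h1 : ∀ B : Set X, MeasurableSet B → ∀ T : C(X, X), ν.map T B = ν (T ⁻¹' B) :=
    fun B hB T => Measure.map_apply T.continuous.measurable hB
  have hm : Measurable (fun T : C(X, X) => ν.map T) := by
    refine Measure.measurable_of_measurable_coe _ fun B hB => ?_
    simp_rw [h1 B hB]
    exact measurable_measure_prodMk_left (measurable_eval hB)
  rw [avgPush, Measure.bind_apply hA hm.aemeasurable]
  exact lintegral_congr fun T => h1 A hA T

/-- `ν` is stationary: `𝔗ᵗ_* ν = ν` for every `t ≥ 0`. -/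
def IsStationary (𝔗 : RandomFlow X) (ν : Measure X) : Prop :=
  ∀ t, 𝔗.avgPush t ν = ν

/-- A Borel set `A` is invariant (modulo `μ`): for each `t`, from `μ`-almost every point the
random transformation `T ∼ 𝔗ᵗ` almost surely stays in `A` if it starts in `A`, and almost surely
stays outside `A` if it starts outside. -/
def IsInvariantSet (𝔗 : RandomFlow X) (μ : Measure X) (A : Set X) : Prop :=
  MeasurableSet A ∧ ∀ t, ∀ᵐ x ∂μ, ∀ᵐ T ∂(𝔗.law t), (T x ∈ A ↔ x ∈ A)

/-- `𝔗` is ergodic with respect to `μ`: `μ` is stationary and every invariant set is trivial. -/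
def IsErgodic (𝔗 : RandomFlow X) (μ : Measure X) : Prop :=
  𝔗.IsStationary μ ∧ ∀ A, 𝔗.IsInvariantSet μ A → μ A = 0 ∨ μ A = 1

/-- `𝔗` is uniquely ergodic with measure `μ`: it is ergodic with respect to `μ`, and `μ` is its
only stationary probability measure. -/
def IsUniquelyErgodic (𝔗 : RandomFlow X) (μ : Measure X) : Prop :=
  𝔗.IsErgodic μ ∧ ∀ ν : Measure X, IsProbabilityMeasure ν → 𝔗.IsStationary ν → ν = μ

/-- `φ` is a random (time-varying) flow, on the probability space `(Ω, P)`, sampled from `𝔗`.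
The distribution is time-invariant: over the interval `[s, s + t]` the transformation has law `𝔗ᵗ`,
whatever `s` is. It is Markov: the transformation over `[s, s + t]` is independent of the history
`(T^r)_{r ≤ s}` of the process `T^r = φ_{0,r}`. -/
structure IsSample (𝔗 : RandomFlow X) {Ω : Type*} [MeasurableSpace Ω] (P : Measure Ω)
    (φ : Ω → TimeVaryingFlow X) : Prop where
  measurable_map : ∀ s t, Measurable (fun ω => (φ ω).map s t)
  measurable_trajectory : ∀ x : X,
    Measurable (fun p : Ω × ℝ≥0 => (φ p.1).map 0 p.2 x)
  law_increment : ∀ s t, P.map (fun ω => (φ ω).map s (s + t)) = 𝔗.law t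
  indep_past : ∀ s t,
    Indep (MeasurableSpace.comap (fun ω => (φ ω).map s (s + t)) inferInstance)
      (⨆ r : Iic s, MeasurableSpace.comap (fun ω => (φ ω).map 0 r) inferInstance) P

end RandomFlow

/-- A trajectory `x : [0, ∞) → X` is ergodic for `μ`: its time averages
`(1/τ) ∫₀^τ δ_{x(t)} dt` converge weakly to `μ` as `τ → ∞`. -/
def IsErgodicTrajectory {X : Type*} [TopologicalSpace X] [MeasurableSpace X]
    (μ : Measure X) (x : ℝ≥0 → X) : Prop :=
  Measurable x ∧ ∀ f : C(X, ℝ),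
    Tendsto (fun τ : ℝ => τ⁻¹ * ∫ t in (0 : ℝ)..τ, f (x t.toNNReal)) atTop (𝓝 (∫ y, f y ∂μ))

/-! Ergodicity is a conditioning argument. If `A` is invariant and not null, then `μ` conditioned on
`A` is again stationary, so by uniqueness it equals `μ`, and `μ A = 1` (`isErgodic_of_unique`).

For a trajectory `x_t`, write `P_s` for `avgObs s`. By the Markov property `f (x_{t+s}) - P_s f
(x_t)` has mean zero given the history up to `t`, so these deviations are uncorrelated at times at
least `s` apart. A second-moment law of large numbers (`ae_tendsto_average_of_decorrelated`) makes
their time averages vanish almost surely. Shifting time by `s` changes a time average negligibly,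
hence the averages of `P_s f - f` along the trajectory tend to zero, and every weak limit of the
occupation measures is preserved by `avgPush s`. Uniqueness identifies the limit, and compactness of
the space of probability measures turns this into convergence.

No continuity of `𝔗.law` in time is available to treat all `s` simultaneously. Fubini gives an
almost sure statement for almost every `s`, which suffices by `isStationary_of_ae`. -/

namespace RandomFlow

/-! ### Averaged observables, duality, and ergodicity from uniqueness. -/

variable {X : Type*} [MetricSpace X] [CompactSpace X]

instance (𝔗 : RandomFlow X) (t : ℝ≥0) : IsProbabilityMeasure (𝔗.law t) :=
  𝔗.isProbabilityMeasure_law t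

/-- The averaged observable `x ↦ 𝔼_{T ∼ 𝔗ᵗ} [f (T x)]`, the dual of `avgPush`. -/
noncomputable def avgObs (𝔗 : RandomFlow X) (t : ℝ≥0) (f : C(X, ℝ)) : C(X, ℝ) where
  toFun x := ∫ T, f (T x) ∂(𝔗.law t)
  continuous_toFun := by
    -- The Feller property: averaging preserves continuity, so `avgObs` can be tested against weak
    -- limits.
    refine continuous_of_dominated (bound := fun _ => ‖f‖) (fun x => ?_) (fun x => ?_)
      (integrable_const _) (ae_of_all _ fun T => by fun_prop)
    · exact (f.continuous.comp (continuous_eval_const x)).measurable.aestronglyMeasurable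
    · exact ae_of_all _ fun _ => f.norm_coe_le_norm _

theorem avgObs_apply (𝔗 : RandomFlow X) (t : ℝ≥0) (f : C(X, ℝ)) (x : X) :
    𝔗.avgObs t f x = ∫ T, f (T x) ∂(𝔗.law t) := rfl

theorem abs_avgObs_le (𝔗 : RandomFlow X) (t : ℝ≥0) (f : C(X, ℝ)) (x : X) :
    |𝔗.avgObs t f x| ≤ ‖f‖ := by
  rw [avgObs_apply, ← Real.norm_eq_abs]
  exact (norm_integral_le_of_norm_le_const (ae_of_all _ fun _ => f.norm_coe_le_norm _)).trans
    (by simp)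

theorem integrable_comp_eval (𝔗 : RandomFlow X) (t : ℝ≥0) (f : C(X, ℝ)) (x : X) :
    Integrable (fun T : C(X, X) => f (T x)) (𝔗.law t) :=
  Integrable.of_bound
    (f.continuous.comp (continuous_eval_const x)).measurable.aestronglyMeasurable ‖f‖
    (ae_of_all _ fun _ => f.norm_coe_le_norm _)

theorem avgObs_sub (𝔗 : RandomFlow X) (t : ℝ≥0) (f g : C(X, ℝ)) :
    𝔗.avgObs t (f - g) = 𝔗.avgObs t f - 𝔗.avgObs t g := by
  ext x
  simp only [avgObs_apply, ContinuousMap.sub_apply]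
  exact integral_sub (integrable_comp_eval 𝔗 t f x) (integrable_comp_eval 𝔗 t g x)

theorem avgObs_avgObs (𝔗 : RandomFlow X) (t s : ℝ≥0) (f : C(X, ℝ)) :
    𝔗.avgObs s (𝔗.avgObs t f) = 𝔗.avgObs (t + s) f := by
  ext x
  have hc : Measurable (fun p : C(X, X) × C(X, X) => p.1.comp p.2) :=
    (ContinuousMap.continuous_comp' (X := X) (Y := X) (Z := X)).measurable.comp measurable_swap
  have hf : Measurable (fun T : C(X, X) => f (T x)) :=
    (f.continuous.comp (continuous_eval_const x)).measurable
  rw [avgObs_apply 𝔗 (t + s), ← 𝔗.law_add, integral_map hc.aemeasurable hf.aestronglyMeasurable,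
    integral_prod_symm]
  · rfl
  · exact Integrable.of_bound (hf.comp hc).aestronglyMeasurable
      ‖f‖ (ae_of_all _ fun _ => f.norm_coe_le_norm _)

variable [MeasurableSpace X] [BorelSpace X]

/-- Realises the averaged push-forward as the law of `T x` for independent `T` and `x`, which opens
it to Fubini. -/
theorem avgPush_eq_map_prod (𝔗 : RandomFlow X) (t : ℝ≥0) (ν : Measure X)
    [IsProbabilityMeasure ν] :
    𝔗.avgPush t ν = ((𝔗.law t).prod ν).map (fun p : C(X, X) × X => p.1 p.2) := by
  ext A hA
  rw [avgPush_apply 𝔗 t ν hA, Measure.map_apply measurable_eval hA,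
    Measure.prod_apply (measurable_eval hA)]
  rfl

instance (𝔗 : RandomFlow X) (t : ℝ≥0) (ν : Measure X) [IsProbabilityMeasure ν] :
    IsProbabilityMeasure (𝔗.avgPush t ν) := by
  rw [avgPush_eq_map_prod]
  exact Measure.isProbabilityMeasure_map measurable_eval.aemeasurable

theorem integral_avgPush (𝔗 : RandomFlow X) (t : ℝ≥0) (ν : Measure X) [IsProbabilityMeasure ν]
    (f : C(X, ℝ)) : ∫ x, f x ∂(𝔗.avgPush t ν) = ∫ x, 𝔗.avgObs t f x ∂ν := by
  rw [avgPush_eq_map_prod, integral_map measurable_eval.aemeasurable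
    f.continuous.measurable.aestronglyMeasurable, integral_prod_symm]
  · rfl
  · exact Integrable.of_bound (f.continuous.measurable.comp measurable_eval).aestronglyMeasurable
      ‖f‖ (ae_of_all _ fun _ => f.norm_coe_le_norm _)

theorem avgPush_eq_of_integral_avgObs (𝔗 : RandomFlow X) (t : ℝ≥0) (ν : Measure X)
    [IsProbabilityMeasure ν] (h : ∀ f : C(X, ℝ), ∫ x, 𝔗.avgObs t f x ∂ν = ∫ x, f x ∂ν) :
    𝔗.avgPush t ν = ν := by
  refine ext_of_forall_integral_eq_of_IsFiniteMeasure fun f => ?_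
  exact (integral_avgPush 𝔗 t ν f.toContinuousMap).trans (h f.toContinuousMap)

theorem avgPush_add (𝔗 : RandomFlow X) (t s : ℝ≥0) (ν : Measure X) [IsProbabilityMeasure ν] :
    𝔗.avgPush (t + s) ν = 𝔗.avgPush t (𝔗.avgPush s ν) := by
  refine ext_of_forall_integral_eq_of_IsFiniteMeasure fun f => ?_
  have h := integral_avgPush 𝔗 t (𝔗.avgPush s ν) f.toContinuousMap
  have h' := integral_avgPush 𝔗 (t + s) ν f.toContinuousMap
  have h2 := integral_avgPush 𝔗 s ν (𝔗.avgObs t f.toContinuousMap)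
  rw [avgObs_avgObs] at h2
  rw [h2] at h
  exact h'.trans h.symm

theorem avgPush_zero (𝔗 : RandomFlow X) (ν : Measure X) [IsProbabilityMeasure ν] :
    𝔗.avgPush 0 ν = ν :=
  avgPush_eq_of_integral_avgObs 𝔗 0 ν fun f => by
    congr with x
    rw [avgObs_apply, 𝔗.law_zero, integral_dirac]
    rfl

/-- The set of times preserving `ν` is closed under addition, so it is everything once it has
full measure. -/
theorem isStationary_of_ae (𝔗 : RandomFlow X) (ν : Measure X) [IsProbabilityMeasure ν]
    (h : ∀ᵐ s : ℝ, 𝔗.avgPush s.toNNReal ν = ν) : 𝔗.IsStationary ν := by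
  intro t
  rcases eq_or_ne t 0 with rfl | ht
  · exact avgPush_zero 𝔗 ν
  have ht' : (0 : ℝ) < t := by positivity
  -- Reflection preserves Lebesgue measure, so some `s` in `(0, t)` has both `s` and `t - s` good.
  have h' : ∀ᵐ s : ℝ, 𝔗.avgPush (t - s : ℝ).toNNReal ν = ν :=
    (Measure.measurePreserving_sub_left volume (t : ℝ)).quasiMeasurePreserving.ae h
  have hpos : ∃ᵐ s : ℝ, s ∈ Ioo (0 : ℝ) t := by
    rw [frequently_ae_mem_iff]
    simpa using ht
  obtain ⟨s, hs, h1, h2⟩ := (hpos.and_eventually (h.and h')).exists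
  have : t = (t - s : ℝ).toNNReal + s.toNNReal := by
    rw [← Real.toNNReal_add (by linarith [hs.2]) hs.1.le]
    simp
  rw [this, avgPush_add, h1, h2]

/-- Under `𝔗.law t × μ` the events `T x ∈ A` and `x ∈ A` agree almost surely, so restricting to `A`
commutes with the averaged push-forward. -/
theorem isErgodic_of_unique (𝔗 : RandomFlow X) (μ : Measure X) [IsProbabilityMeasure μ]
    (hμ : 𝔗.IsStationary μ)
    (hunique : ∀ ν : Measure X, IsProbabilityMeasure ν → 𝔗.IsStationary ν → ν = μ) :
    𝔗.IsErgodic μ := by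
  refine ⟨hμ, fun A ⟨hA, hinv⟩ => or_iff_not_imp_left.2 fun h0 => ?_⟩
  have hprob : IsProbabilityMeasure (cond μ A) := cond_isProbabilityMeasure h0
  have hstat : 𝔗.IsStationary (cond μ A) := by
    intro t
    ext B hB
    have hprod : ∀ᵐ p ∂((𝔗.law t).prod μ), (p.1 p.2 ∈ A ↔ p.2 ∈ A) := by
      have hm : MeasurableSet {p : X × C(X, X) | p.2 p.1 ∈ A ↔ p.1 ∈ A} :=
        (measurable_eval.comp measurable_swap hA).iff (measurable_fst hA)
      rw [← Measure.prod_swap]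
      exact (ae_map_iff measurable_swap.aemeasurable (measurable_swap hm)).2
        ((Measure.ae_prod_iff_ae_ae hm).2 (hinv t))
    have hprodcond : (𝔗.law t).prod (cond μ A)
        = (μ A)⁻¹ • ((𝔗.law t).prod μ).restrict (univ ×ˢ A) := by
      rw [ProbabilityTheory.cond, Measure.prod_smul_right, ← Measure.prod_restrict,
        Measure.restrict_univ]
    rw [avgPush_eq_map_prod, Measure.map_apply measurable_eval hB, hprodcond,
      cond_apply hA, Measure.smul_apply, smul_eq_mul,
      Measure.restrict_apply (measurable_eval hB)]
    congr 1
    -- Stationarity rewrites the mass of `A ∩ B` as that of `T x ∈ A ∩ B`, where invariance applies.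
    conv_rhs => rw [← hμ t]
    rw [avgPush_eq_map_prod, Measure.map_apply measurable_eval (hA.inter hB)]
    refine measure_congr ?_
    filter_upwards [hprod] with p hp
    refine propext ?_
    change (p.1 p.2 ∈ B ∧ (p.1 ∈ univ ∧ p.2 ∈ A)) ↔ (p.1 p.2 ∈ A ∧ p.1 p.2 ∈ B)
    rw [hp]
    simp [and_comm]
  rw [← hunique _ hprob hstat]
  exact cond_apply_self h0 (measure_ne_top _ _)

end RandomFlow

/-! ### A law of large numbers for processes with finite-range correlations. -/

section Decorrelated

theorem integrable_uncurry_of_abs_le {α β : Type*} [MeasurableSpace α] [MeasurableSpace β]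
    {μ : Measure (α × β)} [IsFiniteMeasure μ] {g : α → β → ℝ} {C : ℝ}
    (hg : Measurable (Function.uncurry g)) (hC : ∀ a b, |g a b| ≤ C) :
    Integrable (Function.uncurry g) μ :=
  Integrable.of_bound hg.aestronglyMeasurable C (ae_of_all _ fun p => hC p.1 p.2)

/-- Each slice of the band lies in an interval of length `2 * s`. -/
theorem measureReal_prod_abs_sub_le (n : ℕ) {s : ℝ} (hs : 0 ≤ s) :
    ((volume.restrict (Ioc (0 : ℝ) n)).prod (volume.restrict (Ioc (0 : ℝ) n))).real
      {z | |z.1 - z.2| ≤ s} ≤ 2 * s * n := by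
  have hm : MeasurableSet {z : ℝ × ℝ | |z.1 - z.2| ≤ s} :=
    measurableSet_le (by fun_prop) measurable_const
  refine ENNReal.toReal_le_of_le_ofReal (by positivity) ?_
  rw [Measure.prod_apply hm]
  calc ∫⁻ x, volume.restrict (Ioc (0 : ℝ) n) (Prod.mk x ⁻¹' {z : ℝ × ℝ | |z.1 - z.2| ≤ s})
        ∂(volume.restrict (Ioc (0 : ℝ) n))
      ≤ ∫⁻ _, ENNReal.ofReal (2 * s) ∂(volume.restrict (Ioc (0 : ℝ) n)) := by
        refine lintegral_mono fun x => (Measure.restrict_apply_le _ _).trans ?_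
        rw [← Real.volume_closedBall x s]
        refine measure_mono fun y hy => ?_
        rw [Metric.mem_closedBall, Real.dist_eq, abs_sub_comm]
        exact hy
    _ = ENNReal.ofReal (2 * s * n) := by
        rw [lintegral_const, Measure.restrict_apply_univ, Real.volume_Ioc, sub_zero,
          ← ENNReal.ofReal_mul (by positivity)]

variable {Ω : Type*} [MeasurableSpace Ω] {P : Measure Ω} [IsProbabilityMeasure P]
  {g : Ω → ℝ → ℝ} {C s : ℝ}

/-- The second moment of the time integral of a bounded process whose correlations vanish beyond
the lag `s` grows at most linearly. -/
theorem integral_sq_le_of_decorrelated (hg : Measurable (Function.uncurry g))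
    (hC : ∀ ω t, |g ω t| ≤ C) (hs : 0 ≤ s)
    (hcorr : ∀ t t', 0 ≤ t → t + s ≤ t' → ∫ ω, g ω t * g ω t' ∂P = 0) (n : ℕ) :
    ∫ ω, (∫ t in Ioc (0 : ℝ) n, g ω t) ^ 2 ∂P ≤ C ^ 2 * (2 * s * n) := by
  set m := volume.restrict (Ioc (0 : ℝ) n) with hm
  have hgg : Measurable (Function.uncurry fun (ω : Ω) (z : ℝ × ℝ) => g ω z.1 * g ω z.2) := by
    have h1 : Measurable fun p : Ω × (ℝ × ℝ) => g p.1 p.2.1 :=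
      hg.comp (measurable_fst.prodMk (measurable_fst.comp measurable_snd))
    have h2 : Measurable fun p : Ω × (ℝ × ℝ) => g p.1 p.2.2 :=
      hg.comp (measurable_fst.prodMk (measurable_snd.comp measurable_snd))
    exact h1.mul h2
  have hbound : ∀ ω (z : ℝ × ℝ), |g ω z.1 * g ω z.2| ≤ C ^ 2 := fun ω z => by
    rw [abs_mul, sq]
    exact mul_le_mul (hC _ _) (hC _ _) (abs_nonneg _) ((abs_nonneg _).trans (hC ω z.1))
  have hset : MeasurableSet {z : ℝ × ℝ | |z.1 - z.2| ≤ s} :=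
    measurableSet_le (by fun_prop) measurable_const
  -- The square is a double time integral; after exchanging it with the expectation, only the band
  -- `|t - t'| ≤ s` contributes.
  calc ∫ ω, (∫ t, g ω t ∂m) ^ 2 ∂P
      = ∫ ω, ∫ z, g ω z.1 * g ω z.2 ∂(m.prod m) ∂P := by
        congr with ω
        rw [integral_prod_mul (g ω) (g ω), sq]
    _ = ∫ z, ∫ ω, g ω z.1 * g ω z.2 ∂P ∂(m.prod m) :=
        integral_integral_swap (integrable_uncurry_of_abs_le hgg hbound)
    _ ≤ ∫ z, {z : ℝ × ℝ | |z.1 - z.2| ≤ s}.indicator (fun _ => C ^ 2) z ∂(m.prod m) := by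
        refine integral_mono_ae ?_ ?_ ?_
        · exact (integrable_uncurry_of_abs_le hgg hbound).integral_prod_right
        · exact (integrable_const _).indicator hset
        · have hpos : ∀ᵐ z ∂(m.prod m), z ∈ Ioc (0 : ℝ) n ×ˢ Ioc (0 : ℝ) n := by
            rw [hm, Measure.prod_restrict]
            exact ae_restrict_mem (measurableSet_Ioc.prod measurableSet_Ioc)
          filter_upwards [hpos] with z hz
          by_cases h : |z.1 - z.2| ≤ s
          · rw [indicator_of_mem (by exact h)]
            refine (le_abs_self _).trans ?_
            rw [← Real.norm_eq_abs]
            exact (norm_integral_le_of_norm_le_const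
              (ae_of_all _ fun ω => hbound ω z)).trans (by simp)
          · rw [indicator_of_notMem (by exact h)]
            refine le_of_eq ?_
            rcases lt_abs.1 (not_le.1 h) with h | h
            · simpa only [mul_comm] using hcorr z.2 z.1 hz.2.1.le (by linarith)
            · exact hcorr z.1 z.2 hz.1.1.le (by linarith)
    _ ≤ C ^ 2 * (2 * s * n) := by
        rw [integral_indicator_const _ hset, smul_eq_mul, mul_comm]
        exact mul_le_mul_of_nonneg_left (measureReal_prod_abs_sub_le n hs) (sq_nonneg _)

theorem measurable_setIntegral_of_uncurry (hg : Measurable (Function.uncurry g)) (A : Set ℝ) :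
    Measurable fun ω => ∫ t in A, g ω t :=
  (hg.stronglyMeasurable.integral_prod_right (ν := volume.restrict A)).measurable

/-- The average up to time `n` has second moment `O(1/n)`, which is summable along squares. The sum
of the squared averages is then almost surely finite, so its terms tend to zero. -/
theorem ae_tendsto_average_sq_of_decorrelated (hg : Measurable (Function.uncurry g))
    (hC : ∀ ω t, |g ω t| ≤ C) (hs : 0 ≤ s)
    (hcorr : ∀ t t', 0 ≤ t → t + s ≤ t' → ∫ ω, g ω t * g ω t' ∂P = 0) :
    ∀ᵐ ω ∂P, Tendsto (fun k : ℕ => (∫ t in Ioc (0 : ℝ) ((k + 1) ^ 2 : ℕ), g ω t) /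
      ((k + 1) ^ 2 : ℕ)) atTop (𝓝 0) := by
  set a : ℕ → Ω → ℝ := fun k ω => (∫ t in Ioc (0 : ℝ) ((k + 1) ^ 2 : ℕ), g ω t) /
      ((k + 1) ^ 2 : ℕ) with ha
  have ham : ∀ k, Measurable (a k) := fun k =>
    (measurable_setIntegral_of_uncurry hg _).div_const _
  have hab : ∀ k ω, |a k ω| ≤ C := fun k ω => by
    have hk : (0 : ℝ) < ((k + 1) ^ 2 : ℕ) := by positivity
    rw [ha]
    simp only
    rw [abs_div, abs_of_pos hk, div_le_iff₀ hk, ← Real.norm_eq_abs]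
    refine (norm_setIntegral_le_of_norm_le_const (by simp) fun t _ => hC ω t).trans (le_of_eq ?_)
    rw [Real.volume_real_Ioc_of_le hk.le, sub_zero]
  have hint : ∀ k, ∫⁻ ω, ENNReal.ofReal (a k ω ^ 2) ∂P ≤
      ENNReal.ofReal (C ^ 2 * (2 * s) * (1 / ((k + 1 : ℕ) : ℝ) ^ 2)) := fun k => by
    have hk : (0 : ℝ) < ((k + 1) ^ 2 : ℕ) := by positivity
    have hi : Integrable (fun ω => a k ω ^ 2) P := by
      refine Integrable.of_bound ((ham k).pow_const 2).aestronglyMeasurable (C ^ 2)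
        (ae_of_all _ fun ω => ?_)
      rw [Real.norm_eq_abs, abs_pow]
      exact pow_le_pow_left₀ (abs_nonneg _) (hab k ω) 2
    rw [← ofReal_integral_eq_lintegral_ofReal hi (ae_of_all _ fun ω => sq_nonneg _)]
    refine ENNReal.ofReal_le_ofReal ?_
    simp only [ha, div_pow]
    rw [integral_div, div_le_iff₀ (by positivity)]
    refine (integral_sq_le_of_decorrelated hg hC hs hcorr _).trans (le_of_eq ?_)
    push_cast
    field_simp
  have hsum : ∫⁻ ω, ∑' k, ENNReal.ofReal (a k ω ^ 2) ∂P ≠ ∞ := by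
    rw [lintegral_tsum fun k => ((ham k).pow_const 2).ennreal_ofReal.aemeasurable]
    refine ne_top_of_le_ne_top ?_ (ENNReal.tsum_le_tsum hint)
    have : Summable fun k : ℕ => C ^ 2 * (2 * s) * (1 / ((k + 1 : ℕ) : ℝ) ^ 2) :=
      ((summable_nat_add_iff 1).2
        (Real.summable_one_div_nat_pow.2 one_lt_two)).mul_left (C ^ 2 * (2 * s))
    exact this.tsum_ofReal_ne_top
  have hfin := ae_lt_top (Measurable.tsum fun k => ((ham k).pow_const 2).ennreal_ofReal)
    hsum
  filter_upwards [hfin] with ω hω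
  have h0 := ENNReal.tendsto_atTop_zero_of_tsum_ne_top hω.ne
  have h1 := (ENNReal.tendsto_toReal ENNReal.zero_ne_top).comp h0
  have h2 : Tendsto (fun k => a k ω ^ 2) atTop (𝓝 0) := by
    refine h1.congr fun k => ?_
    simp [ENNReal.toReal_ofReal (sq_nonneg _)]
  have h3 := (Real.continuous_sqrt.tendsto 0).comp h2
  rw [Real.sqrt_zero] at h3
  refine (tendsto_zero_iff_abs_tendsto_zero _).2 (h3.congr fun k => Real.sqrt_sq_eq_abs _)

/-- Adding `C` makes the integrand nonnegative and its integral monotone. Consecutive squares have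
ratio tending to one, so monotonicity fills the gaps between them. -/
theorem tendsto_average_of_tendsto_average_sq {g : ℝ → ℝ} {C : ℝ} (hg : Measurable g)
    (hC : ∀ t, |g t| ≤ C)
    (h : Tendsto (fun k : ℕ => (∫ t in Ioc (0 : ℝ) ((k + 1) ^ 2 : ℕ), g t) / ((k + 1) ^ 2 : ℕ))
      atTop (𝓝 0)) :
    Tendsto (fun n : ℕ => (∫ t in Ioc (0 : ℝ) n, g t) / n) atTop (𝓝 0) := by
  set u : ℕ → ℝ := fun n => ∫ t in Ioc (0 : ℝ) n, (g t + C) with hu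
  have hi : ∀ n : ℕ, IntegrableOn g (Ioc (0 : ℝ) n) := fun n =>
    Integrable.of_bound hg.aestronglyMeasurable C (ae_of_all _ fun t => hC t)
  have hueq : ∀ n, u n = (∫ t in Ioc (0 : ℝ) n, g t) + n * C := fun n => by
    rw [hu]
    simp only
    rw [integral_add (hi n) (integrable_const _)]
    simp
  have hmono : Monotone u := fun n n' hn => by
    refine setIntegral_mono_set ((hi n').add (integrable_const _)) (ae_of_all _ fun t => ?_)
      (Ioc_subset_Ioc_right (by exact_mod_cast hn)).eventuallyLE
    have := neg_le_of_abs_le (hC t)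
    simp only [Pi.zero_apply]
    linarith
  have key : Tendsto (fun n : ℕ => u n / n) atTop (𝓝 C) := by
    refine tendsto_div_of_monotone_of_exists_subseq_tendsto_div u C hmono fun a ha =>
      ⟨fun k => (k + 1) ^ 2, ?_, ?_, ?_⟩
    · have hlim : Tendsto (fun k : ℕ => ((1 : ℝ) + 1 / ((k : ℝ) + 1)) ^ 2) atTop (𝓝 1) := by
        simpa using (tendsto_one_div_add_atTop_nhds_zero_nat (𝕜 := ℝ)).const_add 1 |>.pow 2
      filter_upwards [hlim.eventually_le_const ha] with k hk
      have hk0 : (0 : ℝ) < k + 1 := by positivity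
      have : (((k + 1 + 1) ^ 2 : ℕ) : ℝ) = (1 + 1 / ((k : ℝ) + 1)) ^ 2 * ((k + 1) ^ 2 : ℕ) := by
        push_cast
        field_simp
      rw [this]
      exact mul_le_mul_of_nonneg_right hk (by positivity)
    · exact (tendsto_pow_atTop two_ne_zero).comp (tendsto_add_atTop_nat 1)
    · have := h.add_const C
      rw [zero_add] at this
      refine this.congr fun k => ?_
      rw [hueq, add_div, mul_div_cancel_left₀]
      positivity
  have := key.sub_const C
  rw [sub_self] at this
  refine this.congr' ?_
  filter_upwards [eventually_ne_atTop 0] with n hn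
  rw [hueq, add_div, mul_div_cancel_left₀ _ (by exact_mod_cast hn), add_sub_cancel_right]

/-- A law of large numbers in continuous time for bounded processes whose correlations vanish
beyond some lag. -/
theorem ae_tendsto_average_of_decorrelated (hg : Measurable (Function.uncurry g))
    (hC : ∀ ω t, |g ω t| ≤ C) (hs : 0 ≤ s)
    (hcorr : ∀ t t', 0 ≤ t → t + s ≤ t' → ∫ ω, g ω t * g ω t' ∂P = 0) :
    ∀ᵐ ω ∂P, Tendsto (fun n : ℕ => (∫ t in Ioc (0 : ℝ) n, g ω t) / n) atTop (𝓝 0) := by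
  filter_upwards [ae_tendsto_average_sq_of_decorrelated hg hC hs hcorr] with ω hω
  exact tendsto_average_of_tendsto_average_sq (hg.comp measurable_prodMk_left) (hC ω) hω

end Decorrelated

/-! ### The Markov property and the deviations from prediction. -/

namespace RandomFlow.IsSample

variable {X : Type*} [MetricSpace X] [CompactSpace X] [MeasurableSpace X] [BorelSpace X]
  {𝔗 : RandomFlow X} {Ω : Type*} [MeasurableSpace Ω] {P : Measure Ω} [IsProbabilityMeasure P]
  {φ : Ω → TimeVaryingFlow X}

omit [BorelSpace X] [IsProbabilityMeasure P] in
theorem integral_comp_position (h : 𝔗.IsSample P φ) (f : C(X, ℝ)) (s : ℝ≥0) (x : X) :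
    ∫ ω, f ((φ ω).map 0 s x) ∂P = 𝔗.avgObs s f x := by
  have := h.law_increment 0 s
  rw [zero_add] at this
  rw [avgObs_apply, ← this, integral_map (h.measurable_map 0 s).aemeasurable]
  exact (f.continuous.comp (continuous_eval_const x)).measurable.aestronglyMeasurable

/-- The averaged observables are jointly measurable in time and position as soon as the
distribution admits a sample. -/
theorem measurable_avgObs (h : 𝔗.IsSample P φ) (f : C(X, ℝ)) :
    Measurable fun p : ℝ≥0 × X => 𝔗.avgObs p.1 f p.2 := by
  -- A Carathéodory function: continuous in the position, measurable in `(ω, t)`.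
  have hu : Measurable (Function.uncurry fun (x : X) (p : Ω × ℝ≥0) => (φ p.1).map 0 p.2 x) :=
    measurable_uncurry_of_continuous_of_measurable (fun p => ContinuousMap.continuous _)
      h.measurable_trajectory
  have hm : Measurable (Function.uncurry fun (p : ℝ≥0 × X) (ω : Ω) =>
      f ((φ ω).map 0 p.1 p.2)) :=
    f.continuous.measurable.comp (hu.comp ((measurable_snd.comp measurable_fst).prodMk
      (measurable_snd.prodMk (measurable_fst.comp measurable_fst))))
  have := (hm.stronglyMeasurable.integral_prod_right (ν := P)).measurable
  simpa only [h.integral_comp_position] using this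

/-- The σ-algebra of the history of the flow up to time `t`. -/
abbrev history (φ : Ω → TimeVaryingFlow X) (t : ℝ≥0) : MeasurableSpace Ω :=
  ⨆ r : Iic t, MeasurableSpace.comap (fun ω => (φ ω).map 0 r) inferInstance

omit [CompactSpace X] [BorelSpace X] [IsProbabilityMeasure P] in
theorem history_le (h : 𝔗.IsSample P φ) (t : ℝ≥0) : history φ t ≤ ‹MeasurableSpace Ω› :=
  iSup_le fun r => (h.measurable_map 0 r).comap_le

omit [CompactSpace X] [MeasurableSpace Ω] in
theorem measurable_position_history {r t : ℝ≥0} (hrt : r ≤ t) (x : X) :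
    Measurable[history φ t] fun ω => (φ ω).map 0 r x := by
  have h1 : Measurable[history φ t] fun ω => (φ ω).map 0 r :=
    (comap_measurable _).mono
      (le_iSup (fun r : Iic t => MeasurableSpace.comap (fun ω => (φ ω).map 0 r) inferInstance)
        ⟨r, hrt⟩) le_rfl
  exact (continuous_eval_const x).measurable.comp h1

/-- The Markov property, tested against a bounded function of the past. -/
theorem integral_mul_past (h : 𝔗.IsSample P φ) (f : C(X, ℝ)) (x : X) (s t : ℝ≥0)
    {k : Ω → ℝ} (hk : Measurable[history φ t] k) {K : ℝ} (hK : ∀ ω, |k ω| ≤ K) :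
    ∫ ω, k ω * f ((φ ω).map 0 (t + s) x) ∂P
      = ∫ ω, k ω * 𝔗.avgObs s f ((φ ω).map 0 t x) ∂P := by
  have hY : Measurable[history φ t] fun ω => ((φ ω).map 0 t x, k ω) :=
    Measurable.prodMk (measurable_position_history le_rfl x) hk
  have hY' : Measurable fun ω => ((φ ω).map 0 t x, k ω) := hY.mono (h.history_le t) le_rfl
  have hT := h.measurable_map t (t + s)
  -- The increment is independent of the pair jointly, because both components belong to the
  -- history.
  have hind : IndepFun (fun ω => (φ ω).map t (t + s)) (fun ω => ((φ ω).map 0 t x, k ω)) P :=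
    (IndepFun_iff_Indep _ _ _).2 (indep_of_indep_of_le_right (h.indep_past t s) hY.comap_le)
  have hlaw := (indepFun_iff_map_prod_eq_prod_map_map hT.aemeasurable hY'.aemeasurable).1 hind
  rw [h.law_increment] at hlaw
  have hprob : IsProbabilityMeasure (P.map fun ω => ((φ ω).map 0 t x, k ω)) :=
    Measure.isProbabilityMeasure_map hY'.aemeasurable
  have hF : Measurable fun q : C(X, X) × (X × ℝ) => q.2.2 * f (q.1 q.2.1) :=
    (measurable_snd.comp measurable_snd).mul (f.continuous.measurable.comp
      (measurable_eval.comp (measurable_fst.prodMk (measurable_fst.comp measurable_snd))))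
  have hF' : Measurable fun q : X × ℝ => q.2 * 𝔗.avgObs s f q.1 :=
    measurable_snd.mul ((𝔗.avgObs s f).continuous.measurable.comp measurable_fst)
  calc ∫ ω, k ω * f ((φ ω).map 0 (t + s) x) ∂P
      = ∫ q, q.2.2 * f (q.1 q.2.1)
          ∂(P.map fun ω => ((φ ω).map t (t + s), ((φ ω).map 0 t x, k ω))) := by
        rw [integral_map (hT.prodMk hY').aemeasurable hF.aestronglyMeasurable]
        refine integral_congr_ae (ae_of_all _ fun ω => ?_)
        change k ω * f _ = k ω * f (((φ ω).map t (t + s)) ((φ ω).map 0 t x))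
        rw [← (φ ω).map_comp 0 t (t + s) bot_le le_self_add]
        rfl
    _ = ∫ q : X × ℝ, q.2 * 𝔗.avgObs s f q.1 ∂(P.map fun ω => ((φ ω).map 0 t x, k ω)) := by
        rw [hlaw, integral_prod_symm]
        · simp only [integral_const_mul, avgObs_apply]
        · rw [← hlaw, integrable_map_measure hF.aestronglyMeasurable (hT.prodMk hY').aemeasurable]
          refine Integrable.of_bound (hF.comp (hT.prodMk hY')).aestronglyMeasurable (K * ‖f‖)
            (ae_of_all _ fun ω => ?_)
          simp only [Function.comp_apply, norm_mul]
          exact mul_le_mul (hK ω) (f.norm_coe_le_norm _) (norm_nonneg _)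
            ((abs_nonneg _).trans (hK ω))
    _ = _ := integral_map hY'.aemeasurable hF'.aestronglyMeasurable

/-- The deviation of an observable after a further lapse of time `s` from its prediction. -/
noncomputable def deviation (𝔗 : RandomFlow X) (φ : Ω → TimeVaryingFlow X) (x : X)
    (f : C(X, ℝ)) (s : ℝ≥0) (ω : Ω) (t : ℝ) : ℝ :=
  f ((φ ω).map 0 (t.toNNReal + s) x) - 𝔗.avgObs s f ((φ ω).map 0 t.toNNReal x)

theorem measurable_deviation (h : 𝔗.IsSample P φ) (x : X) (f : C(X, ℝ)) :
    Measurable fun p : ℝ≥0 × Ω × ℝ => deviation 𝔗 φ x f p.1 p.2.1 p.2.2 := by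
  have hω : Measurable fun p : ℝ≥0 × Ω × ℝ => p.2.1 := measurable_fst.comp measurable_snd
  have ht : Measurable fun p : ℝ≥0 × Ω × ℝ => p.2.2.toNNReal :=
    (measurable_snd.comp measurable_snd).real_toNNReal
  refine (f.continuous.measurable.comp
    ((h.measurable_trajectory x).comp (hω.prodMk (ht.add measurable_fst)))).sub ?_
  exact (h.measurable_avgObs f).comp
    (measurable_fst.prodMk ((h.measurable_trajectory x).comp (hω.prodMk ht)))

omit [MeasurableSpace X] [BorelSpace X] [MeasurableSpace Ω] in
theorem abs_deviation_le (x : X) (f : C(X, ℝ)) (s : ℝ≥0) (ω : Ω) (t : ℝ) :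
    |deviation 𝔗 φ x f s ω t| ≤ 2 * ‖f‖ := by
  refine (abs_sub _ _).trans ?_
  have h1 := f.norm_coe_le_norm ((φ ω).map 0 (t.toNNReal + s) x)
  have h2 := abs_avgObs_le 𝔗 s f ((φ ω).map 0 t.toNNReal x)
  rw [Real.norm_eq_abs] at h1
  linarith

/-- The deviation at `t` looks ahead only to `t + s ≤ t'`, so it belongs to the history at `t'`,
given which the later deviation has mean zero. -/
theorem integral_deviation_mul (h : 𝔗.IsSample P φ) (x : X) (f : C(X, ℝ)) (s : ℝ≥0)
    (t t' : ℝ) (ht : 0 ≤ t) (htt : t + s ≤ t') :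
    ∫ ω, deviation 𝔗 φ x f s ω t * deviation 𝔗 φ x f s ω t' ∂P = 0 := by
  have hle : t.toNNReal + s ≤ t'.toNNReal := by
    have hadd := Real.toNNReal_add ht s.coe_nonneg
    rw [Real.toNNReal_coe] at hadd
    rw [← hadd]
    exact Real.toNNReal_le_toNNReal htt
  have hk : Measurable[history φ t'.toNNReal] fun ω => deviation 𝔗 φ x f s ω t :=
    (f.continuous.measurable.comp (measurable_position_history hle x)).sub
      ((𝔗.avgObs s f).continuous.measurable.comp
        (measurable_position_history (le_self_add.trans hle) x))
  have hk' := hk.mono (h.history_le _) le_rfl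
  have hpos : ∀ r : ℝ≥0, Measurable fun ω => (φ ω).map 0 r x := fun r =>
    (continuous_eval_const x).measurable.comp (h.measurable_map 0 r)
  have hint : ∀ (g : C(X, ℝ)) (r : ℝ≥0),
      Integrable (fun ω => deviation 𝔗 φ x f s ω t * g ((φ ω).map 0 r x)) P := fun g r => by
    refine Integrable.of_bound
      (hk'.mul (g.continuous.measurable.comp (hpos r))).aestronglyMeasurable (2 * ‖f‖ * ‖g‖)
      (ae_of_all _ fun ω => ?_)
    rw [norm_mul]
    exact mul_le_mul (abs_deviation_le x f s ω t) (g.norm_coe_le_norm _) (norm_nonneg _)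
      (by positivity)
  have key := h.integral_mul_past f x s t'.toNNReal hk (abs_deviation_le x f s · t)
  simp only [deviation, mul_sub] at key hint ⊢
  rw [integral_sub (hint _ _) (hint _ _), key, sub_self]

theorem ae_tendsto_average_deviation (h : 𝔗.IsSample P φ) (x : X) (f : C(X, ℝ)) (s : ℝ≥0) :
    ∀ᵐ ω ∂P, Tendsto (fun n : ℕ => (∫ t in Ioc (0 : ℝ) n, deviation 𝔗 φ x f s ω t) / n)
      atTop (𝓝 0) :=
  ae_tendsto_average_of_decorrelated ((h.measurable_deviation x f).comp measurable_prodMk_left)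
    (abs_deviation_le x f s) s.2 (h.integral_deviation_mul x f s)

/-- Almost surely, for almost every lapse of time `s`, the deviations average out. -/
theorem ae_ae_tendsto_average_deviation (h : 𝔗.IsSample P φ) (x : X) (f : C(X, ℝ)) :
    ∀ᵐ ω ∂P, ∀ᵐ s : ℝ, Tendsto (fun n : ℕ =>
      (∫ t in Ioc (0 : ℝ) n, deviation 𝔗 φ x f s.toNNReal ω t) / n) atTop (𝓝 0) := by
  -- Fubini exchanges the quantifiers; this is where joint measurability in `(s, ω)` is needed.
  refine (Measure.ae_ae_comm ?_).1
    (ae_of_all _ fun s : ℝ => h.ae_tendsto_average_deviation x f s.toNNReal)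
  refine measurableSet_tendsto _ fun n => Measurable.div_const ?_ _
  have hm : Measurable (Function.uncurry fun (p : ℝ × Ω) (t : ℝ) =>
      deviation 𝔗 φ x f p.1.toNNReal p.2 t) :=
    (h.measurable_deviation x f).comp
      ((measurable_fst.comp measurable_fst).real_toNNReal.prodMk
        ((measurable_snd.comp measurable_fst).prodMk measurable_snd))
  exact (hm.stronglyMeasurable.integral_prod_right
    (ν := volume.restrict (Ioc (0 : ℝ) n))).measurable

end RandomFlow.IsSample

/-! ### Elementary facts on time averages of bounded functions. -/

section TimeAverages

theorem intervalIntegrable_of_abs_le {F : ℝ → ℝ} {C : ℝ} (hF : Measurable F)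
    (hC : ∀ t, |F t| ≤ C) (a b : ℝ) : IntervalIntegrable F volume a b :=
  (intervalIntegrable_const (c := C)).mono_fun hF.aestronglyMeasurable
    (ae_of_all _ fun t => (hC t).trans (le_abs_self C))

theorem abs_intervalIntegral_le_of_abs_le {F : ℝ → ℝ} {C : ℝ} (hC : ∀ t, |F t| ≤ C) (a b : ℝ) :
    |∫ t in a..b, F t| ≤ C * |b - a| :=
  Real.norm_eq_abs (∫ t in a..b, F t) ▸
    intervalIntegral.norm_integral_le_of_norm_le_const fun t _ => hC t

/-- Time averages of a bounded function along the integers control those along the reals. -/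
theorem tendsto_average_of_tendsto_average_nat {F : ℝ → ℝ} {C L : ℝ} (hF : Measurable F)
    (hC : ∀ t, |F t| ≤ C)
    (h : Tendsto (fun n : ℕ => (∫ t in (0 : ℝ)..n, F t) / n) atTop (𝓝 L)) :
    Tendsto (fun τ : ℝ => τ⁻¹ * ∫ t in (0 : ℝ)..τ, F t) atTop (𝓝 L) := by
  have hint := intervalIntegrable_of_abs_le hF hC
  have h1 : Tendsto (fun τ : ℝ => (∫ t in (0 : ℝ)..⌊τ⌋₊, F t) / ⌊τ⌋₊ * (⌊τ⌋₊ / τ))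
      atTop (𝓝 L) := by
    simpa using (h.comp (tendsto_nat_floor_atTop (α := ℝ))).mul
      (tendsto_nat_floor_div_atTop (R := ℝ))
  have h2 : Tendsto (fun τ : ℝ => τ⁻¹ * ∫ t in (⌊τ⌋₊ : ℝ)..τ, F t) atTop (𝓝 0) := by
    refine squeeze_zero_norm' ?_ (by simpa using tendsto_inv_atTop_zero.mul_const C)
    filter_upwards [eventually_gt_atTop 0] with τ hτ
    rw [norm_mul, Real.norm_eq_abs, abs_of_pos (inv_pos.2 hτ)]
    refine mul_le_mul_of_nonneg_left ?_ (inv_pos.2 hτ).le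
    refine (abs_intervalIntegral_le_of_abs_le hC _ _).trans ?_
    have hfl := Nat.floor_le hτ.le
    have hlt := Nat.lt_floor_add_one τ
    rw [abs_of_nonneg (sub_nonneg.2 hfl)]
    exact mul_le_of_le_one_right ((abs_nonneg _).trans (hC 0)) (by linarith)
  have h3 := h1.add h2
  rw [add_zero] at h3
  refine h3.congr' ?_
  filter_upwards [eventually_ge_atTop 1] with τ hτ
  have hτ0 : τ ≠ 0 := by positivity
  have hfl : (⌊τ⌋₊ : ℝ) ≠ 0 := by
    exact_mod_cast (Nat.floor_pos.2 hτ).ne'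
  rw [← intervalIntegral.integral_add_adjacent_intervals (hint 0 ⌊τ⌋₊) (hint ⌊τ⌋₊ τ)]
  field_simp

/-- The shift only exchanges two end windows of length `|s|`, so the numerator stays bounded. -/
theorem tendsto_average_shift_sub {F : ℝ → ℝ} {C : ℝ} (hF : Measurable F)
    (hC : ∀ t, |F t| ≤ C) (s : ℝ) :
    Tendsto (fun n : ℕ => (∫ t in (0 : ℝ)..n, (F (t + s) - F t)) / n) atTop (𝓝 0) := by
  have hint := intervalIntegrable_of_abs_le hF hC
  have hint' : ∀ a b : ℝ, IntervalIntegrable (fun t => F (t + s)) volume a b :=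
    intervalIntegrable_of_abs_le (hF.comp (measurable_add_const s)) fun t => hC (t + s)
  refine squeeze_zero_norm (fun n => ?_) (tendsto_const_div_atTop_nhds_zero_nat (C * |s| + C * |s|))
  rw [norm_div, Real.norm_eq_abs, Real.norm_natCast]
  refine div_le_div_of_nonneg_right ?_ n.cast_nonneg
  have hswap : ∫ t in (0 : ℝ)..n, (F (t + s) - F t)
      = (∫ t in (n : ℝ)..n + s, F t) - ∫ t in (0 : ℝ)..0 + s, F t := by
    rw [intervalIntegral.integral_sub (hint' 0 n) (hint 0 n),
      intervalIntegral.integral_comp_add_right (fun t => F t) s,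
      intervalIntegral.integral_interval_sub_interval_comm' (hint _ _) (hint _ _) (hint _ _)]
  rw [hswap]
  refine (abs_sub _ _).trans (add_le_add ?_ ?_)
  · simpa using abs_intervalIntegral_le_of_abs_le hC (n : ℝ) (n + s)
  · simpa using abs_intervalIntegral_le_of_abs_le hC (0 : ℝ) (0 + s)

end TimeAverages

/-! ### Occupation measures and their weak limits. -/

section Empirical

variable {X : Type*} [MetricSpace X] [CompactSpace X] [MeasurableSpace X] [BorelSpace X]

/-- The occupation measure of the trajectory `y` over the time interval `(0, n + 1]`. -/
noncomputable def occupationMeasure (y : ℝ → X) (n : ℕ) : Measure X :=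
  (ENNReal.ofReal (n + 1))⁻¹ • (volume.restrict (Ioc (0 : ℝ) (n + 1))).map y

omit [MetricSpace X] [CompactSpace X] [BorelSpace X] in
theorem isProbabilityMeasure_occupationMeasure {y : ℝ → X} (hy : Measurable y) (n : ℕ) :
    IsProbabilityMeasure (occupationMeasure y n) := by
  refine ⟨?_⟩
  rw [occupationMeasure, Measure.smul_apply, Measure.map_apply hy .univ, preimage_univ,
    Measure.restrict_apply_univ, Real.volume_Ioc, sub_zero, smul_eq_mul]
  exact ENNReal.inv_mul_cancel (by simp; positivity) ENNReal.ofReal_ne_top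

omit [CompactSpace X] in
theorem integral_occupationMeasure {y : ℝ → X} (hy : Measurable y) (f : C(X, ℝ)) (n : ℕ) :
    ∫ x, f x ∂(occupationMeasure y n)
      = (∫ t in (0 : ℝ)..(n + 1 : ℕ), f (y t)) / (n + 1 : ℕ) := by
  rw [occupationMeasure, integral_smul_measure,
    integral_map hy.aemeasurable f.continuous.measurable.aestronglyMeasurable,
    intervalIntegral.integral_of_le (by positivity), ENNReal.toReal_inv,
    ENNReal.toReal_ofReal (by positivity), smul_eq_mul, inv_mul_eq_div]
  push_cast
  rfl

namespace RandomFlow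

/-- A trajectory along which the observables are asymptotically preserved by the averaged dynamics
is ergodic for the unique stationary measure. -/
theorem isErgodicTrajectory_of_tendsto_avgObs_sub (𝔗 : RandomFlow X) (μ : Measure X)
    (hunique : ∀ ν : Measure X, IsProbabilityMeasure ν → 𝔗.IsStationary ν → ν = μ)
    {y : ℝ≥0 → X} (hy : Measurable y)
    (h : ∀ᵐ s : ℝ, ∀ f : C(X, ℝ), Tendsto (fun n : ℕ =>
      (∫ t in (0 : ℝ)..n, (𝔗.avgObs s.toNNReal f - f) (y t.toNNReal)) / n) atTop (𝓝 0)) :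
    IsErgodicTrajectory μ y := by
  set z : ℝ → X := fun t => y t.toNNReal with hz_def
  have hz : Measurable z := hy.comp measurable_real_toNNReal
  refine ⟨hy, fun f => tendsto_average_of_tendsto_average_nat
    (f.continuous.measurable.comp hz) (fun t => f.norm_coe_le_norm _) ?_⟩
  set N : ℕ → ProbabilityMeasure X := fun n =>
    ⟨occupationMeasure z n, isProbabilityMeasure_occupationMeasure hz n⟩ with hN
  have hNint : ∀ (g : C(X, ℝ)) n, ∫ x, g x ∂(N n : Measure X)
      = (∫ t in (0 : ℝ)..(n + 1 : ℕ), g (z t)) / (n + 1 : ℕ) :=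
    fun g n => integral_occupationMeasure hz g n
  have hlim : ∀ (U : Filter ℕ) (ν : ProbabilityMeasure X), Tendsto N U (𝓝 ν) →
      ∀ g : C(X, ℝ), Tendsto (fun n => ∫ x, g x ∂(N n : Measure X)) U (𝓝 (∫ x, g x ∂ν)) :=
    fun U ν hν g => ProbabilityMeasure.tendsto_iff_forall_integral_tendsto.1 hν
      (BoundedContinuousFunction.mkOfCompact g)
  have hcluster : ∀ ν : ProbabilityMeasure X, MapClusterPt ν atTop N → (ν : Measure X) = μ := by
    intro ν hν
    -- Along an ultrafilter the cluster point is a genuine limit, so integrals of continuous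
    -- functions converge.
    obtain ⟨U, hU, hUν⟩ := mapClusterPt_iff_ultrafilter.1 hν
    refine hunique ν inferInstance (isStationary_of_ae 𝔗 ν ?_)
    filter_upwards [h] with s hs
    refine avgPush_eq_of_integral_avgObs 𝔗 _ ν fun g => ?_
    have h1 : Tendsto (fun n => ∫ x, (𝔗.avgObs s.toNNReal g - g) x ∂(N n : Measure X)) U
        (𝓝 0) := by
      simp only [hNint]
      exact ((hs g).comp (tendsto_add_atTop_nat 1)).mono_left hU
    have h2 := tendsto_nhds_unique (hlim U ν hUν (𝔗.avgObs s.toNNReal g - g)) h1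
    have hi : ∀ k : C(X, ℝ), Integrable k (ν : Measure X) := fun k =>
      Integrable.of_bound k.continuous.measurable.aestronglyMeasurable ‖k‖
        (ae_of_all _ k.norm_coe_le_norm)
    simp only [ContinuousMap.sub_apply] at h2
    rw [integral_sub (hi _) (hi _)] at h2
    exact sub_eq_zero.1 h2
  obtain ⟨ν, hν⟩ : ∃ ν : ProbabilityMeasure X, MapClusterPt ν atTop N :=
    let ⟨ν, _, hν⟩ := isCompact_univ (f := map N atTop) (by simp)
    ⟨ν, hν⟩
  -- In a compact space, a sequence with a single cluster point converges to it.
  have hconv : Tendsto N atTop (𝓝 ν) := tendsto_nhds_of_unique_mapClusterPt fun ν' hν' =>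
    Subtype.ext ((hcluster ν' hν').trans (hcluster ν hν).symm)
  have := hlim atTop ν hconv f
  rw [hcluster ν hν] at this
  simp only [hNint] at this
  exact (tendsto_add_atTop_iff_nat 1).1 this

/-- Asymptotic preservation by the averaged dynamics only needs to be tested on a dense set of
observables. -/
theorem tendsto_avgObs_sub_of_dense (𝔗 : RandomFlow X) (s : ℝ≥0) {z : ℝ → X} (hz : Measurable z)
    {D : Set C(X, ℝ)} (hD : Dense D)
    (h : ∀ f ∈ D, Tendsto (fun n : ℕ =>
      (∫ t in (0 : ℝ)..n, (𝔗.avgObs s f - f) (z t)) / n) atTop (𝓝 0)) (f : C(X, ℝ)) :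
    Tendsto (fun n : ℕ => (∫ t in (0 : ℝ)..n, (𝔗.avgObs s f - f) (z t)) / n) atTop (𝓝 0) := by
  rw [Metric.tendsto_nhds]
  intro ε hε
  -- Since `avgObs` is a contraction, replacing `f` by `g` costs at most `2 * ‖f - g‖ < ε / 2`.
  obtain ⟨g, hg, hfg⟩ := hD.exists_dist_lt f (show 0 < ε / 4 by positivity)
  filter_upwards [(Metric.tendsto_nhds.1 (h g hg)) (ε / 2) (by positivity)] with n hn
  rw [dist_zero_right] at hn ⊢
  have hint : ∀ k : C(X, ℝ), IntervalIntegrable (fun t => k (z t)) volume 0 n := fun k =>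
    intervalIntegrable_of_abs_le (k.continuous.measurable.comp hz)
      (fun t => k.norm_coe_le_norm _) _ _
  have hdiff : (∫ t in (0 : ℝ)..n, (𝔗.avgObs s f - f) (z t)) / n
      - (∫ t in (0 : ℝ)..n, (𝔗.avgObs s g - g) (z t)) / n
      = (∫ t in (0 : ℝ)..n, (𝔗.avgObs s (f - g) - (f - g)) (z t)) / n := by
    rw [← sub_div, ← intervalIntegral.integral_sub (hint _) (hint _)]
    congr 2 with t
    rw [avgObs_sub]
    simp only [ContinuousMap.sub_apply]
    ring
  have hbound : ‖(∫ t in (0 : ℝ)..n, (𝔗.avgObs s (f - g) - (f - g)) (z t)) / n‖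
      ≤ 2 * ‖f - g‖ := by
    rw [norm_div, Real.norm_eq_abs, Real.norm_natCast]
    refine div_le_of_le_mul₀ n.cast_nonneg (by positivity) ?_
    refine (abs_intervalIntegral_le_of_abs_le (C := 2 * ‖f - g‖) (fun t => ?_) _ _).trans
      (by simp)
    rw [ContinuousMap.sub_apply, two_mul]
    exact (abs_sub _ _).trans
      (add_le_add (abs_avgObs_le 𝔗 s (f - g) _) ((f - g).norm_coe_le_norm _))
  rw [dist_eq_norm] at hfg
  have := norm_sub_norm_le ((∫ t in (0 : ℝ)..n, (𝔗.avgObs s f - f) (z t)) / n)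
    ((∫ t in (0 : ℝ)..n, (𝔗.avgObs s g - g) (z t)) / n)
  rw [hdiff] at this
  linarith

/-- Along the trajectory, `P_s f - f` is the time-shift increment of `f` minus the deviation, and
both average to zero. -/
theorem IsSample.tendsto_avgObs_sub_of_deviation {𝔗 : RandomFlow X} {Ω : Type*}
    {φ : Ω → TimeVaryingFlow X} {x : X} {ω : Ω} (hy : Measurable fun t => (φ ω).map 0 t x)
    (f : C(X, ℝ)) (s : ℝ≥0)
    (h : Tendsto (fun n : ℕ => (∫ t in Ioc (0 : ℝ) n, deviation 𝔗 φ x f s ω t) / n)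
      atTop (𝓝 0)) :
    Tendsto (fun n : ℕ => (∫ t in (0 : ℝ)..n,
      (𝔗.avgObs s f - f) ((φ ω).map 0 t.toNNReal x)) / n) atTop (𝓝 0) := by
  have hz : Measurable fun t : ℝ => (φ ω).map 0 t.toNNReal x :=
    hy.comp measurable_real_toNNReal
  have hm : ∀ k : C(X, ℝ), Measurable fun t : ℝ => k ((φ ω).map 0 t.toNNReal x) := fun k =>
    k.continuous.measurable.comp hz
  have hb : ∀ (k : C(X, ℝ)) (t : ℝ), |k ((φ ω).map 0 t.toNNReal x)| ≤ ‖k‖ := fun k t =>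
    k.norm_coe_le_norm _
  have hi : ∀ (k : C(X, ℝ)) (a b : ℝ),
      IntervalIntegrable (fun t : ℝ => k ((φ ω).map 0 t.toNNReal x)) volume a b := fun k =>
    intervalIntegrable_of_abs_le (hm k) (hb k)
  have hi' : ∀ a b : ℝ,
      IntervalIntegrable (fun t : ℝ => f ((φ ω).map 0 (t + s).toNNReal x)) volume a b :=
    intervalIntegrable_of_abs_le ((hm f).comp (measurable_add_const (s : ℝ)))
      fun t => hb f (t + s)
  have key := (tendsto_average_shift_sub (hm f) (hb f) s).sub h
  rw [sub_zero] at key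
  refine key.congr fun n => ?_
  have hdev : ∫ t in Ioc (0 : ℝ) n, deviation 𝔗 φ x f s ω t
      = ∫ t in (0 : ℝ)..n, (f ((φ ω).map 0 (t + s).toNNReal x)
        - 𝔗.avgObs s f ((φ ω).map 0 t.toNNReal x)) := by
    rw [intervalIntegral.integral_of_le n.cast_nonneg]
    -- Truncation by `toNNReal` commutes with adding `s` because `t` is nonnegative here.
    refine setIntegral_congr_fun measurableSet_Ioc fun t ht => ?_
    simp only [deviation]
    rw [Real.toNNReal_add ht.1.le s.coe_nonneg, Real.toNNReal_coe]
  rw [hdev, ← sub_div]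
  congr 1
  rw [← intervalIntegral.integral_sub ((hi' _ _).sub (hi _ _ _)) ((hi' _ _).sub (hi _ _ _))]
  congr 1 with t
  simp

/-- Separability of `C(X, ℝ)` leaves countably many observables to test, so the exceptional sets, in
`ω` and then in `s`, remain null. -/
theorem IsSample.ae_isErgodicTrajectory {𝔗 : RandomFlow X} {μ : Measure X}
    (hunique : ∀ ν : Measure X, IsProbabilityMeasure ν → 𝔗.IsStationary ν → ν = μ)
    {Ω : Type*} [MeasurableSpace Ω] {P : Measure Ω} [IsProbabilityMeasure P]
    {φ : Ω → TimeVaryingFlow X} (h : 𝔗.IsSample P φ) (x : X) :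
    ∀ᵐ ω ∂P, IsErgodicTrajectory μ (fun t => (φ ω).map 0 t x) := by
  filter_upwards [ae_all_iff.2 fun i : ℕ =>
    h.ae_ae_tendsto_average_deviation x (TopologicalSpace.denseSeq C(X, ℝ) i)] with ω hω
  have hy : Measurable fun t => (φ ω).map 0 t x :=
    (h.measurable_trajectory x).comp measurable_prodMk_left
  refine isErgodicTrajectory_of_tendsto_avgObs_sub 𝔗 μ hunique hy ?_
  filter_upwards [ae_all_iff.2 hω] with s hs
  refine tendsto_avgObs_sub_of_dense 𝔗 s.toNNReal (hy.comp measurable_real_toNNReal)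
    (TopologicalSpace.denseRange_denseSeq C(X, ℝ)) ?_
  rintro _ ⟨i, rfl⟩
  exact IsSample.tendsto_avgObs_sub_of_deviation hy _ _ (hs i)

end RandomFlow

end Empirical

theorem theorem2 {X : Type*} [MetricSpace X] [CompactSpace X] [MeasurableSpace X] [BorelSpace X]
    (𝔗 : RandomFlow X) (μ : Measure X) [IsProbabilityMeasure μ]
    (hμ : 𝔗.IsStationary μ)
    (hunique : ∀ ν : Measure X, IsProbabilityMeasure ν → 𝔗.IsStationary ν → ν = μ) :
    𝔗.IsUniquelyErgodic μ ∧
      ∀ {Ω : Type*} [MeasurableSpace Ω] (P : Measure Ω) [IsProbabilityMeasure P]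
        (φ : Ω → TimeVaryingFlow X), 𝔗.IsSample P φ →
        ∀ x₀ : X, ∀ᵐ ω ∂P, IsErgodicTrajectory μ (fun t => (φ ω).map 0 t x₀) :=
  ⟨⟨𝔗.isErgodic_of_unique μ hμ hunique, hunique⟩, fun _ _ _ hφ x₀ =>
    hφ.ae_isErgodicTrajectory hunique x₀⟩
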